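/- Let $\mathbb F$ be $\mathbb R$ or $\mathbb C$, $\lambda\in\mathbb F^n$, and for $k=1,\dots,n$ let $\Omega_k$ be a finite set of multi-indices $I=(I_1,\dots,I_n)\in\mathbb Z^n$ with $I_k\ge -1$, $I_j\ge 0$ for $j\ne k$, and $I_1+\dots+I_n\ge 1$. Consider the polynomial system $$\dot x_k=\lambda_k x_k+x_k\sum_{I\in\Omega_k}a^{(k)}_I x^{I},\qquad k=1,\dots,n, \tag{sys}$$ with parameters $a=(a^{(k)}_I)$, $\ell=|\Omega_1|+\dots+|\Omega_n|$ in number. Write $I_q$ for the multi-index of the $q$-th parameter $a_q$, and for $\mu\in\mathbb N_0^\ell$ put $a^\mu=\prod_q a_q^{\mu_q}$, $|\mu|=\sum_q\mu_q$ and $L(\mu)=\sum_q\mu_q I_q\in\mathbb Z^n$. Let $M$ be the space of formal vector fields of the form $\sum_\mu(\theta_\mu\odot x)\,a^\mu x^{L(\mu)}$ (finite or infinite sums), with $\theta_\mu\in\mathbb F^n$, $\odot$ the componentwise product, and only monomials with nonnegative exponents in $x$ occurring in the components; the term with index $\mu$ has level $|\mu|$, and it is resonant if $\langle L(\mu),\lambda\rangle=0$.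 An equation $\dot y=g(a,y)$ is in normal form up to level $s$ if $g\in M$, the level $0$ part of $g$ is $\lambda\odot y$, and all nonresonant terms of $g$ of levels $1,\dots,s$ are zero. Then for every $s\in\mathbb N_0$ there are maps $H_1,\dots,H_s$, polynomial in $x$ and in the parameters $a$, where $H_k(a,x)-x$ belongs to $M$ and has only terms of level at least $k$, such that the transformation $y=H(a,x)$, $H=H_s\circ\dots\circ H_1$ (composition in $x$ with $a$ fixed), takes (sys) to an equation $\dot y=g(a,y)$ that is in normal form up to level $s$; that is, $$D_xH(a,x)\,\bigl(\lambda_k x_k+x_k\textstyle\sum_{I\in\Omega_k}a^{(k)}_I x^{I}\bigr)_{k=1}^n=g\bigl(a,H(a,x)\bigr)$$ as formal power series in $(a,x)$. -/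

import Mathlib

/-!
Formal vector fields with parameters. The family
`ẋ_k = λ_k x_k + x_k ∑_{I ∈ Ω_k} a^{(k)}_I x^I`, `k = 1, …, n`,
has one parameter `a^{(k)}_I` for every `k` and every `I ∈ Ω_k`.
-/

/-- Admissible exponents: an element of `Ω k` has `k`-th entry at least `-1`, all other entries
nonnegative, and its entries sum to at least `1` (so `x_k x^I` is a monomial of degree at
least `2`). -/
def IsAdmissible {n : ℕ} (Ω : Fin n → Finset (Fin n → ℤ)) : Prop :=
  ∀ k, ∀ I ∈ Ω k, -1 ≤ I k ∧ (∀ j, j ≠ k → 0 ≤ I j) ∧ 1 ≤ ∑ j, I j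

/-- The index set of the parameters `a^{(k)}_I`; it has `ℓ = |Ω_1| + ⋯ + |Ω_n|` elements. -/
abbrev Param {n : ℕ} (Ω : Fin n → Finset (Fin n → ℤ)) : Type :=
  Σ k : Fin n, {I : Fin n → ℤ // I ∈ Ω k}

/-- All variables: `Sum.inl q` is the parameter `a_q`, `Sum.inr j` is the coordinate `x_j`. -/
abbrev Var {n : ℕ} (Ω : Fin n → Finset (Fin n → ℤ)) : Type := Param Ω ⊕ Fin n

/-- Formal vector fields, with components in `𝕜[[a, x]]`. -/
abbrev FormalField {n : ℕ} (𝕜 : Type*) [Field 𝕜] (Ω : Fin n → Finset (Fin n → ℤ)) : Type _ :=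
  Fin n → MvPowerSeries (Var Ω) 𝕜

/-- Maps `x ↦ H(a, x)` that are polynomial in `x` and in the parameters `a`. -/
abbrev PolyMap {n : ℕ} (𝕜 : Type*) [Field 𝕜] (Ω : Fin n → Finset (Fin n → ℤ)) : Type _ :=
  Fin n → MvPolynomial (Var Ω) 𝕜

/-- For `d` the exponent of the monomial `a^μ x^β`, this is `L(μ) = ∑_q μ_q I_q ∈ ℤⁿ`, where `I_q`
is the multi-index of the parameter `a_q`. -/
def Lmap {n : ℕ} {Ω : Fin n → Finset (Fin n → ℤ)} (d : Var Ω →₀ ℕ) : Fin n → ℤ :=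
  fun j => ∑ q : Param Ω, (d (Sum.inl q) : ℤ) * q.2.1 j

/-- The level `|μ|` of the monomial `a^μ x^β` with exponent `d`. -/
def level {n : ℕ} {Ω : Fin n → Finset (Fin n → ℤ)} (d : Var Ω →₀ ℕ) : ℕ :=
  ∑ q : Param Ω, d (Sum.inl q)

/-- The module `M` of formal vector fields `∑_μ (θ_μ ⊙ x) a^μ x^{L(μ)}` (possibly infinite sums):
every monomial `a^μ x^β` of the `i`-th component satisfies `β = L(μ) + e_i`. -/
def MemM {n : ℕ} {𝕜 : Type*} [Field 𝕜] {Ω : Fin n → Finset (Fin n → ℤ)}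
    (V : FormalField 𝕜 Ω) : Prop :=
  ∀ (i : Fin n) (d : Var Ω →₀ ℕ), MvPowerSeries.coeff d (V i) ≠ 0 →
    ∀ j : Fin n, (d (Sum.inr j) : ℤ) = Lmap d j + (if j = i then 1 else 0)

/-- `V ∈ M` is of level at least `k`: all its terms `(θ ⊙ x) a^μ x^{L(μ)}` have `|μ| ≥ k`. -/
def LevelAtLeast {n : ℕ} {𝕜 : Type*} [Field 𝕜] {Ω : Fin n → Finset (Fin n → ℤ)}
    (k : ℕ) (V : FormalField 𝕜 Ω) : Prop :=
  MemM V ∧ ∀ (i : Fin n) (d : Var Ω →₀ ℕ), MvPowerSeries.coeff d (V i) ≠ 0 → k ≤ level d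

/-- The right-hand side of the system
`ẋ_k = λ_k x_k + x_k ∑_{I ∈ Ω_k} a^{(k)}_I x^I`.
For admissible `Ω` the exponents `I_j + δ_{jk}` of `x_k x^I` are nonnegative, so `Int.toNat`
does not change them. -/
noncomputable def sysField {n : ℕ} {𝕜 : Type*} [Field 𝕜]
    (Ω : Fin n → Finset (Fin n → ℤ)) (lam : Fin n → 𝕜) : FormalField 𝕜 Ω :=
  fun k => MvPowerSeries.C (lam k) * MvPowerSeries.X (Sum.inr k) +
    ∑ I : {I : Fin n → ℤ // I ∈ Ω k},
      MvPowerSeries.X (Sum.inl ⟨k, I⟩) *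
        ∏ j : Fin n, MvPowerSeries.X (Sum.inr j) ^ (I.1 j + (if j = k then 1 else 0)).toNat

/-- The equation `ẋ = V` has the form `ẋ = λ ⊙ x + a_1(x) + a_2(x) + ⋯`, where `a_s` is a vector
field in `M` of level `s`. -/
def HasLevelForm {n : ℕ} {𝕜 : Type*} [Field 𝕜] {Ω : Fin n → Finset (Fin n → ℤ)}
    (lam : Fin n → 𝕜) (V : FormalField 𝕜 Ω) : Prop :=
  MemM V ∧ ∀ (i : Fin n) (d : Var Ω →₀ ℕ), level d = 0 →
    MvPowerSeries.coeff d (V i) =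
      MvPowerSeries.coeff d (MvPowerSeries.C (lam i) * MvPowerSeries.X (Sum.inr i))

/-- A term `(θ ⊙ x) a^μ x^{L(μ)}` is resonant if `⟨L(μ), λ⟩ = 0`. -/
def IsResonant {n : ℕ} {𝕜 : Type*} [Field 𝕜] {Ω : Fin n → Finset (Fin n → ℤ)}
    (lam : Fin n → 𝕜) (d : Var Ω →₀ ℕ) : Prop :=
  ∑ j : Fin n, (Lmap d j : 𝕜) * lam j = 0

/-- The equation `ẋ = V` is in normal form up to level `s`: it has the form
`ẋ = λ ⊙ x + a_1(x) + a_2(x) + ⋯` and all nonresonant terms of `a_1, …, a_s` vanish. -/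
def IsNormalFormUpToLevel {n : ℕ} {𝕜 : Type*} [Field 𝕜] {Ω : Fin n → Finset (Fin n → ℤ)}
    (lam : Fin n → 𝕜) (s : ℕ) (V : FormalField 𝕜 Ω) : Prop :=
  HasLevelForm lam V ∧ ∀ (i : Fin n) (d : Var Ω →₀ ℕ), 1 ≤ level d → level d ≤ s →
    ¬ IsResonant lam d → MvPowerSeries.coeff d (V i) = 0

/-- The identity map `x ↦ x`. -/
noncomputable def idMap {n : ℕ} (𝕜 : Type*) [Field 𝕜] (Ω : Fin n → Finset (Fin n → ℤ)) :
    PolyMap 𝕜 Ω :=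
  fun i => MvPolynomial.X (Sum.inr i)

/-- The composition `x ↦ G(a, H(a, x))`. -/
noncomputable def PolyMap.comp {n : ℕ} {𝕜 : Type*} [Field 𝕜] {Ω : Fin n → Finset (Fin n → ℤ)}
    (G H : PolyMap 𝕜 Ω) : PolyMap 𝕜 Ω :=
  fun i => MvPolynomial.bind₁ (Sum.elim (fun q => MvPolynomial.X (Sum.inl q)) H) (G i)

/-- The composition `H s ∘ ⋯ ∘ H 1`. -/
noncomputable def iterComp {n : ℕ} {𝕜 : Type*} [Field 𝕜] {Ω : Fin n → Finset (Fin n → ℤ)}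
    (H : ℕ → PolyMap 𝕜 Ω) : ℕ → PolyMap 𝕜 Ω
  | 0 => idMap 𝕜 Ω
  | s + 1 => PolyMap.comp (H (s + 1)) (iterComp H s)

/-- The difference `H(a, x) - x`, as a formal vector field. -/
noncomputable def PolyMap.subId {n : ℕ} {𝕜 : Type*} [Field 𝕜] {Ω : Fin n → Finset (Fin n → ℤ)}
    (H : PolyMap 𝕜 Ω) : FormalField 𝕜 Ω :=
  fun i => ((H i - MvPolynomial.X (Sum.inr i) : MvPolynomial (Var Ω) 𝕜) :
    MvPowerSeries (Var Ω) 𝕜)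

/-- The substitution `y = H(a, x)` takes `ẋ = V(a, x)` to `ẏ = W(a, y)`: the identity
`D_x H(a, x) V(a, x) = W(a, H(a, x))` of formal power series, where `H` has no constant term,
so that the formal substitution is meaningful. -/
def Transforms {n : ℕ} {𝕜 : Type*} [Field 𝕜] {Ω : Fin n → Finset (Fin n → ℤ)}
    (H : PolyMap 𝕜 Ω) (V W : FormalField 𝕜 Ω) : Prop :=
  (∀ i, MvPolynomial.constantCoeff (H i) = 0) ∧
  ∀ i : Fin n,
    ∑ j : Fin n, ((MvPolynomial.pderiv (Sum.inr j) (H i) : MvPolynomial (Var Ω) 𝕜) :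
        MvPowerSeries (Var Ω) 𝕜) * V j =
      MvPowerSeries.subst
        (Sum.elim (fun q => MvPowerSeries.X (Sum.inl q))
          (fun j => ((H j : MvPolynomial (Var Ω) 𝕜) : MvPowerSeries (Var Ω) 𝕜)) :
          Var Ω → MvPowerSeries (Var Ω) 𝕜) (W i)

/-!
Give the monomial `a^μ x^β` the weight `β - L(μ) ∈ ℤⁿ`. A formal vector field lies in `M` exactly if
its `i`-th component is homogeneous of weight `e_i` (`memM_iff`), and weights are additive, so
membership in `M` passes to derivatives along fields in `M` and to substitutions by maps whose
components have the same weights as the coordinates (`MvPowerSeries.subst_mem_weightSubmodule`). The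
series of level at least `m` form ideals with `I_m I_k ⊆ I_{m+k}`.

The substitution `T` by `x + h`, with `h` of level at least `r ≥ 1`, satisfies
`(T - 1) I_m ⊆ I_{m+r}` (`MvPowerSeries.subst_sub_self_mem_levelIdeal`). Therefore `T` is bijective on
formal power series, its inverse being the level-wise finite sum `∑ (1 - T)^k`, which again
preserves weights (`MvPowerSeries.exists_mem_weightSubmodule_map_eq`). Hence every near-identity map
transforms `V ∈ M` into a unique field `W = T⁻¹(D_x H · V)` of `M`; no inverse of the map itself is
needed.

If `h` has level at least `s + 1`, then comparing both sides modulo `I_{s+2}` shows that up to level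
`s + 1` the field `W` is `V` plus the Lie bracket of `h` with `λ ⊙ x`
(`exists_transforms_of_level`). On a term of `M` with index `μ` this bracket is multiplication by
`⟨L(μ), λ⟩`, so a choice of `h` of level exactly `s + 1` removes all nonresonant terms of that level
(`IsNormalFormUpToLevel.exists_succ`); `h` is a polynomial because only finitely many monomials have
a given level and weight. The steps are put together by the chain rule (`Transforms.comp`).
-/

/-! ### Level ideals and weight spaces of power series -/

namespace MvPowerSeries

section Grading

variable {σ R : Type*} [CommRing R]

/-- The ideal of power series all of whose monomials have level at least `m`, where the level of
an exponent is given by an additive map `ℓ` to the natural numbers. -/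
def levelIdeal (R : Type*) [CommRing R] (ℓ : (σ →₀ ℕ) →+ ℕ) (m : ℕ) :
    Ideal (MvPowerSeries σ R) where
  carrier := {f | ∀ d, ℓ d < m → coeff d f = 0}
  zero_mem' := fun d _ => by simp
  add_mem' := fun {f g} hf hg d hd => by simp [hf d hd, hg d hd]
  smul_mem' := fun c f hf d hd => by
    classical
    rw [smul_eq_mul, coeff_mul]
    refine Finset.sum_eq_zero fun p hp => ?_
    rw [Finset.HasAntidiagonal.mem_antidiagonal] at hp
    have h : ℓ p.1 + ℓ p.2 = ℓ d := by rw [← map_add, hp]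
    rw [hf p.2 (by omega), mul_zero]

/-- The power series all of whose monomials have weight `w`, where the weight of an exponent is
given by an additive map `ω`. -/
def weightSubmodule {A : Type*} [AddCommMonoid A] (R : Type*) [CommRing R] (ω : (σ →₀ ℕ) →+ A)
    (w : A) : Submodule R (MvPowerSeries σ R) where
  carrier := {f | ∀ d, coeff d f ≠ 0 → ω d = w}
  zero_mem' := fun d hd => absurd (by simp) hd
  add_mem' := fun {f g} hf hg d hd => by
    by_cases h : coeff d f = 0
    · exact hg d fun h' => hd (by simp [h, h'])
    · exact hf d h
  smul_mem' := fun c f hf d hd => hf d fun h => hd (by simp [h])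

variable {A : Type*} [AddCommMonoid A] {ℓ : (σ →₀ ℕ) →+ ℕ} {ω : (σ →₀ ℕ) →+ A}

theorem mem_levelIdeal {m : ℕ} {f : MvPowerSeries σ R} :
    f ∈ levelIdeal R ℓ m ↔ ∀ d, ℓ d < m → coeff d f = 0 := Iff.rfl

theorem mem_weightSubmodule {w : A} {f : MvPowerSeries σ R} :
    f ∈ weightSubmodule R ω w ↔ ∀ d, coeff d f ≠ 0 → ω d = w := Iff.rfl

theorem levelIdeal_anti {m k : ℕ} (h : m ≤ k) : levelIdeal R ℓ k ≤ levelIdeal R ℓ m :=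
  fun _ hf d hd => hf d (hd.trans_le h)

theorem levelIdeal_zero : levelIdeal R ℓ 0 = ⊤ :=
  eq_top_iff.2 fun _ _ _ hd => absurd hd (Nat.not_lt_zero _)

theorem mul_mem_levelIdeal {m k : ℕ} {f g : MvPowerSeries σ R}
    (hf : f ∈ levelIdeal R ℓ m) (hg : g ∈ levelIdeal R ℓ k) :
    f * g ∈ levelIdeal R ℓ (m + k) := by
  classical
  intro d hd
  rw [coeff_mul]
  refine Finset.sum_eq_zero fun p hp => ?_
  rw [Finset.HasAntidiagonal.mem_antidiagonal] at hp
  have h : ℓ p.1 + ℓ p.2 = ℓ d := by rw [← map_add, hp]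
  by_cases h1 : ℓ p.1 < m
  · rw [hf p.1 h1, zero_mul]
  · rw [hg p.2 (by omega), mul_zero]

theorem mul_mem_weightSubmodule {v w : A} {f g : MvPowerSeries σ R}
    (hf : f ∈ weightSubmodule R ω v) (hg : g ∈ weightSubmodule R ω w) :
    f * g ∈ weightSubmodule R ω (v + w) := by
  classical
  intro d hd
  rw [coeff_mul] at hd
  obtain ⟨p, hp, hne⟩ := Finset.exists_ne_zero_of_sum_ne_zero hd
  rw [Finset.HasAntidiagonal.mem_antidiagonal] at hp
  rw [← hp, map_add, hf _ (left_ne_zero_of_mul hne), hg _ (right_ne_zero_of_mul hne)]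

theorem one_mem_weightSubmodule : (1 : MvPowerSeries σ R) ∈ weightSubmodule R ω 0 := by
  classical
  intro d hd
  rw [coeff_one] at hd
  rw [(ite_ne_right_iff.1 hd).1, map_zero]

theorem X_mem_weightSubmodule (v : σ) :
    (X v : MvPowerSeries σ R) ∈ weightSubmodule R ω (ω (Finsupp.single v 1)) := by
  classical
  intro d hd
  rw [coeff_X] at hd
  rw [(ite_ne_right_iff.1 hd).1]

theorem pow_mem_weightSubmodule {w : A} {f : MvPowerSeries σ R}
    (hf : f ∈ weightSubmodule R ω w) (k : ℕ) : f ^ k ∈ weightSubmodule R ω (k • w) := by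
  induction k with
  | zero => simpa using one_mem_weightSubmodule
  | succ k ih => rw [pow_succ, succ_nsmul]; exact mul_mem_weightSubmodule ih hf

theorem prod_mem_weightSubmodule {ι : Type*} (s : Finset ι) {w : ι → A}
    {f : ι → MvPowerSeries σ R} (hf : ∀ i ∈ s, f i ∈ weightSubmodule R ω (w i)) :
    ∏ i ∈ s, f i ∈ weightSubmodule R ω (∑ i ∈ s, w i) := by
  classical
  induction s using Finset.induction_on with
  | empty => simpa using one_mem_weightSubmodule
  | insert a s ha ih =>
    rw [Finset.prod_insert ha, Finset.sum_insert ha]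
    exact mul_mem_weightSubmodule (hf a (Finset.mem_insert_self a s))
      (ih fun i hi => hf i (Finset.mem_insert_of_mem hi))

theorem monomial_mem_levelIdeal (d : σ →₀ ℕ) (r : R) :
    monomial d r ∈ levelIdeal R ℓ (ℓ d) := by
  classical
  intro e he
  rw [coeff_monomial, if_neg]
  rintro rfl
  exact lt_irrefl _ he

end Grading

/-! ### Substitution and the grading -/

section Substitution

variable {σ R : Type*} [CommRing R] {A : Type*} [AddCommMonoid A]
  {ℓ : (σ →₀ ℕ) →+ ℕ} {ω : (σ →₀ ℕ) →+ A} {a : σ → MvPowerSeries σ R}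

/-- A substitution that replaces every variable by a series of the same weight preserves
weights. -/
theorem subst_mem_weightSubmodule (ha : HasSubst a)
    (hω : ∀ v, a v ∈ weightSubmodule R ω (ω (Finsupp.single v 1))) {w : A}
    {f : MvPowerSeries σ R} (hf : f ∈ weightSubmodule R ω w) :
    subst a f ∈ weightSubmodule R ω w := by
  intro e he
  rw [coeff_subst ha] at he
  obtain ⟨d, hd⟩ := not_forall.1 fun h => he (finsum_eq_zero_of_forall_eq_zero h)
  have hprod : (d.prod fun v k => a v ^ k) ∈ weightSubmodule R ω (ω d) := by
    have : ω d = ∑ v ∈ d.support, d v • ω (Finsupp.single v 1) := by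
      conv_lhs => rw [← Finsupp.sum_single d, Finsupp.sum, map_sum]
      exact Finset.sum_congr rfl fun v _ => by rw [← map_nsmul]; simp
    rw [this]
    exact prod_mem_weightSubmodule _ fun v _ => pow_mem_weightSubmodule (hω v) _
  rw [smul_eq_mul] at hd
  rw [hprod e (right_ne_zero_of_mul hd), hf d (left_ne_zero_of_mul hd)]

/-- If `a v` and the variable `v` agree up to terms of level `ℓ v + r`, then the same holds with
any monomial in place of `v`. -/
theorem prod_pow_sub_monomial_mem_levelIdeal {r : ℕ}
    (h : ∀ v, a v - X v ∈ levelIdeal R ℓ (ℓ (Finsupp.single v 1) + r)) (d : σ →₀ ℕ) :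
    (d.prod fun v k => a v ^ k) - monomial d 1 ∈ levelIdeal R ℓ (ℓ d + r) := by
  classical
  have key : ∀ d e : σ →₀ ℕ,
      (d.prod fun v k => a v ^ k) - monomial d 1 ∈ levelIdeal R ℓ (ℓ d + r) →
      (e.prod fun v k => a v ^ k) - monomial e 1 ∈ levelIdeal R ℓ (ℓ e + r) →
      ((d + e).prod fun v k => a v ^ k) - monomial (d + e) 1 ∈
        levelIdeal R ℓ (ℓ (d + e) + r) := by
    intro d e hd he
    have hd' : (d.prod fun v k => a v ^ k) ∈ levelIdeal R ℓ (ℓ d) := by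
      simpa using add_mem (levelIdeal_anti (Nat.le_add_right _ r) hd)
        (monomial_mem_levelIdeal (R := R) (ℓ := ℓ) d 1)
    have h1 := mul_mem_levelIdeal hd' he
    have h2 := mul_mem_levelIdeal hd (monomial_mem_levelIdeal (R := R) (ℓ := ℓ) e 1)
    have h3 : ((d + e).prod fun v k => a v ^ k) =
        (d.prod fun v k => a v ^ k) * (e.prod fun v k => a v ^ k) :=
      Finsupp.prod_add_index' (fun _ => pow_zero _) fun _ _ _ => pow_add _ _ _
    have h4 : (monomial (d + e) 1 : MvPowerSeries σ R) = monomial d 1 * monomial e 1 := by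
      rw [monomial_mul_monomial, one_mul]
    have e1 : ℓ (d + e) + r = ℓ d + (ℓ e + r) := by rw [map_add, add_assoc]
    have e2 : ℓ d + r + ℓ e = ℓ d + (ℓ e + r) := by omega
    rw [e2] at h2
    rw [e1, h3, h4]
    convert! add_mem h1 h2 using 1
    ring
  have hzero : (monomial (0 : σ →₀ ℕ) (1 : R) : MvPowerSeries σ R) = 1 := rfl
  have hsingle : ∀ v (k : ℕ), ((Finsupp.single v k).prod fun v k => a v ^ k) -
      monomial (Finsupp.single v k) 1 ∈ levelIdeal R ℓ (ℓ (Finsupp.single v k) + r) := by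
    intro v k
    induction k with
    | zero => simp [hzero]
    | succ k ih =>
      rw [Finsupp.single_add]
      refine key _ _ ih ?_
      rw [Finsupp.prod_single_index (h := fun v k => a v ^ k) (pow_zero _), pow_one]
      exact h v
  induction d using Finsupp.induction_linear with
  | zero => simp [hzero]
  | add d e hd he => exact key d e hd he
  | single v k => exact hsingle v k

/-- A substitution that moves every variable by terms of relative level `r` changes a series of
level `m` only by terms of level `m + r`. -/
theorem subst_sub_self_mem_levelIdeal (ha : HasSubst a) {r : ℕ}
    (h : ∀ v, a v - X v ∈ levelIdeal R ℓ (ℓ (Finsupp.single v 1) + r)) {m : ℕ}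
    {f : MvPowerSeries σ R} (hf : f ∈ levelIdeal R ℓ m) :
    subst a f - f ∈ levelIdeal R ℓ (m + r) := by
  classical
  intro e he
  have hterm : ∀ d, coeff d f • coeff e (d.prod fun v k => a v ^ k) =
      coeff d f • coeff e (d.prod fun v k => (X v : MvPowerSeries σ R) ^ k) := by
    intro d
    by_cases hd : ℓ d < m
    · rw [hf d hd, zero_smul, zero_smul]
    · have := prod_pow_sub_monomial_mem_levelIdeal h d e (by omega)
      rw [map_sub, sub_eq_zero, monomial_eq', map_one, one_mul] at this
      rw [this]
  have : coeff e (subst a f) = coeff e (subst (X : σ → MvPowerSeries σ R) f) := by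
    rw [coeff_subst ha, coeff_subst HasSubst.X]
    exact finsum_congr hterm
  rw [map_sub, this, subst_self, id, sub_self]

end Substitution

/-! ### Operators that are the identity up to higher level -/

section Unipotent

variable {σ R : Type*} [CommRing R] {A : Type*} [AddCommMonoid A]
  {ℓ : (σ →₀ ℕ) →+ ℕ} {ω : (σ →₀ ℕ) →+ A} {T : MvPowerSeries σ R →ₗ[R] MvPowerSeries σ R}

theorem mem_levelIdeal_of_map_mem
    (hT : ∀ m, ∀ f ∈ levelIdeal R ℓ m, T f - f ∈ levelIdeal R ℓ (m + 1)) {m : ℕ}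
    {f : MvPowerSeries σ R} (hf : T f ∈ levelIdeal R ℓ m) : f ∈ levelIdeal R ℓ m := by
  have : ∀ k ≤ m, f ∈ levelIdeal R ℓ k := by
    intro k
    induction k with
    | zero => intro _; rw [levelIdeal_zero]; trivial
    | succ k ih =>
      intro hk
      simpa using sub_mem (levelIdeal_anti hk hf) (hT k f (ih (by omega)))
  exact this m le_rfl

/-- A linear endomorphism that is the identity up to terms of higher level is onto, and preimages
inherit homogeneity for a weight: the inverse is `∑ k, (1 - T) ^ k`, of which only finitely many
terms contribute to any one coefficient. -/
theorem exists_mem_weightSubmodule_map_eq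
    (hT : ∀ m, ∀ f ∈ levelIdeal R ℓ m, T f - f ∈ levelIdeal R ℓ (m + 1)) {w : A}
    (hw : ∀ f ∈ weightSubmodule R ω w, T f ∈ weightSubmodule R ω w)
    {F : MvPowerSeries σ R} (hF : F ∈ weightSubmodule R ω w) :
    ∃ W ∈ weightSubmodule R ω w, T W = F := by
  set N : Module.End R (MvPowerSeries σ R) := 1 - T with hN
  set S : ℕ → MvPowerSeries σ R := fun m => ∑ k ∈ Finset.range m, (N ^ k) F with hS
  have hNF : ∀ k, (N ^ k) F ∈ levelIdeal R ℓ k := by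
    intro k
    induction k with
    | zero => rw [levelIdeal_zero]; trivial
    | succ k ih =>
      rw [pow_succ', Module.End.mul_apply]
      have := neg_mem (hT k _ ih)
      simpa [hN] using this
  have hNw : ∀ k, (N ^ k) F ∈ weightSubmodule R ω w := by
    intro k
    induction k with
    | zero => simpa using hF
    | succ k ih =>
      rw [pow_succ', Module.End.mul_apply]
      simpa [hN] using sub_mem ih (hw _ ih)
  have hTS : ∀ m, T (S m) - F ∈ levelIdeal R ℓ m := by
    intro m
    have h1 : T (S m) = F - (N ^ m) F := by
      induction m with
      | zero => simp [hS]
      | succ m ih =>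
        have h2 : S (m + 1) = S m + (N ^ m) F := by simp [hS, Finset.sum_range_succ]
        have h3 : (N ^ (m + 1)) F = (N ^ m) F - T ((N ^ m) F) := by
          rw [pow_succ', Module.End.mul_apply]; simp [hN]
        rw [h2, map_add, ih, h3]
        abel
    rw [h1]
    simpa using neg_mem (hNF m)
  have hSS : ∀ m k, m ≤ k → S k - S m ∈ levelIdeal R ℓ m := by
    intro m k hmk
    induction k, hmk using Nat.le_induction with
    | base => simp
    | succ k hk ih =>
      have h2 : S (k + 1) - S m = (S k - S m) + (N ^ k) F := by
        simp only [hS, Finset.sum_range_succ]; abel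
      rw [h2]
      exact add_mem ih (levelIdeal_anti hk (hNF k))
  -- all partial sums from index `ℓ d + 1` on have the same coefficient at `d`
  let W : MvPowerSeries σ R := fun d => coeff d (S (ℓ d + 1))
  have hWc : ∀ d, coeff d W = coeff d (S (ℓ d + 1)) := fun _ => rfl
  have hWS : ∀ m, W - S m ∈ levelIdeal R ℓ m := by
    intro m d hd
    have := hSS (ℓ d + 1) m hd d (Nat.lt_succ_self _)
    rw [map_sub, sub_eq_zero] at this
    rw [map_sub, hWc, this, sub_self]
  refine ⟨W, fun d hd => ?_, ?_⟩
  · rw [hWc] at hd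
    exact Submodule.sum_mem _ (fun k _ => hNw k) d hd
  · ext d
    have h1 : T W - F ∈ levelIdeal R ℓ (ℓ d + 1) := by
      have h2 := levelIdeal_anti (Nat.le_succ _) (hT _ _ (hWS (ℓ d + 1)))
      have h3 := add_mem (add_mem h2 (hWS (ℓ d + 1))) (hTS (ℓ d + 1))
      convert! h3 using 1
      rw [map_sub]
      abel
    have := h1 d (Nat.lt_succ_self _)
    rwa [map_sub, sub_eq_zero] at this

end Unipotent

end MvPowerSeries

/-! ### Partial derivatives of polynomials -/

namespace MvPolynomial

variable {σ R : Type*} [CommSemiring R]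

theorem coeff_pderiv_mul_X (v : σ) (p : MvPolynomial σ R) (d : σ →₀ ℕ) :
    coeff d (pderiv v p * X v) = d v * coeff d p := by
  classical
  induction p using MvPolynomial.induction_on' with
  | monomial m r =>
    rw [mul_comm, X_mul_pderiv_monomial, coeff_smul, coeff_monomial, nsmul_eq_mul]
    split_ifs with h
    · rw [h]
    · simp
  | add p q hp hq => rw [map_add, add_mul, coeff_add, hp, hq, coeff_add, mul_add]

/-- The chain rule for the substitution of polynomials for the variables. -/
theorem pderiv_bind₁ {σ τ R : Type*} [CommSemiring R] [Fintype σ] (f : σ → MvPolynomial τ R)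
    (v : τ) (p : MvPolynomial σ R) :
    pderiv v (bind₁ f p) = ∑ u, bind₁ f (pderiv u p) * pderiv v (f u) := by
  classical
  induction p using MvPolynomial.induction_on with
  | C r => simp
  | add p q hp hq => simp only [map_add, hp, hq, add_mul, Finset.sum_add_distrib]
  | mul_X p w hp =>
    have h : ∀ u, bind₁ f (pderiv u (p * X w)) * pderiv v (f u) =
        f w * (bind₁ f (pderiv u p) * pderiv v (f u)) +
          if u = w then bind₁ f p * pderiv v (f u) else 0 := by
      intro u
      by_cases huw : u = w
      · subst huw
        simp only [pderiv_mul, pderiv_X_self, map_add, map_mul, bind₁_X_right, map_one, if_true]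
        ring
      · simp only [pderiv_mul, pderiv_X_of_ne (Ne.symm huw), map_add, map_mul, bind₁_X_right,
          map_zero, if_neg huw]
        ring
    rw [Finset.sum_congr rfl fun u _ => h u, Finset.sum_add_distrib, ← Finset.mul_sum, ← hp,
      Finset.sum_ite_eq' Finset.univ w, if_pos (Finset.mem_univ w), map_mul, bind₁_X_right,
      pderiv_mul]
    ring

end MvPolynomial

/-! ### The grading of the family by level and weight -/

section Family

variable {n : ℕ} {𝕜 : Type*} [Field 𝕜] {Ω : Fin n → Finset (Fin n → ℤ)}

/-- The level as an additive map on exponents. -/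
def levelHom (Ω : Fin n → Finset (Fin n → ℤ)) : (Var Ω →₀ ℕ) →+ ℕ where
  toFun := level
  map_zero' := by simp [level]
  map_add' := fun d e => by simp [level, Finset.sum_add_distrib]

/-- The weight `β - L(μ)` of the monomial `a^μ x^β`, as an additive map on exponents. -/
def weightHom (Ω : Fin n → Finset (Fin n → ℤ)) : (Var Ω →₀ ℕ) →+ (Fin n → ℤ) where
  toFun d j := d (Sum.inr j) - Lmap d j
  map_zero' := by ext j; simp [Lmap]
  map_add' := fun d e => by
    ext j
    simp only [Lmap, Finsupp.add_apply, Nat.cast_add, add_mul, Finset.sum_add_distrib,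
      Pi.add_apply]
    ring

theorem levelHom_apply (d : Var Ω →₀ ℕ) : levelHom Ω d = level d := rfl

theorem weightHom_apply (d : Var Ω →₀ ℕ) (j : Fin n) :
    weightHom Ω d j = d (Sum.inr j) - Lmap d j := rfl

theorem levelHom_single_inr (j : Fin n) : levelHom Ω (Finsupp.single (Sum.inr j) 1) = 0 := by
  simp [levelHom_apply, level]

theorem levelHom_single_inl (q : Param Ω) : levelHom Ω (Finsupp.single (Sum.inl q) 1) = 1 := by
  classical
  simp [levelHom_apply, level, Finsupp.single_apply]

theorem weightHom_single_inr (i : Fin n) :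
    weightHom Ω (Finsupp.single (Sum.inr i) 1) = Pi.single i 1 := by
  classical
  ext j
  simp [weightHom_apply, Lmap, Finsupp.single_apply, Pi.single_apply, eq_comm]

theorem weightHom_single_inl (q : Param Ω) :
    weightHom Ω (Finsupp.single (Sum.inl q) 1) = -q.2.1 := by
  classical
  ext j
  simp [weightHom_apply, Lmap, Finsupp.single_apply]

/-- A formal vector field lies in `M` exactly if its `i`-th component is homogeneous of weight
`e_i`. -/
theorem memM_iff {V : FormalField 𝕜 Ω} :
    MemM V ↔ ∀ i, V i ∈ MvPowerSeries.weightSubmodule 𝕜 (weightHom Ω) (Pi.single i 1) := by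
  refine forall_congr' fun i => forall_congr' fun d => imp_congr_right fun _ => ?_
  rw [funext_iff]
  refine forall_congr' fun j => ?_
  rw [weightHom_apply, Pi.single_apply]
  constructor <;> intro h <;> linarith

/-- There are only finitely many monomials of given level and weight. -/
theorem finite_level_weight (m : ℕ) (w : Fin n → ℤ) :
    {d : Var Ω →₀ ℕ | level d = m ∧ weightHom Ω d = w}.Finite := by
  let b : Var Ω → ℕ := Sum.elim (fun _ => m)
    fun j => (w j + ∑ q : Param Ω, (m : ℤ) * |q.2.1 j|).toNat
  refine (Set.finite_Iic (Finsupp.equivFunOnFinite.symm b)).subset ?_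
  rintro d ⟨hd, hw⟩ v
  have hq : ∀ q, d (Sum.inl q) ≤ m := fun q => by
    rw [← hd]
    exact Finset.single_le_sum (f := fun q : Param Ω => d (Sum.inl q))
      (fun _ _ => Nat.zero_le _) (Finset.mem_univ q)
  rcases v with q | j
  · exact hq q
  · have h1 : Lmap d j ≤ ∑ q : Param Ω, (m : ℤ) * |q.2.1 j| := by
      refine Finset.sum_le_sum fun q _ => ?_
      have h3 : (d (Sum.inl q) : ℤ) ≤ m := by exact_mod_cast hq q
      exact (mul_le_mul_of_nonneg_left (le_abs_self _) (Int.natCast_nonneg _)).trans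
        (mul_le_mul_of_nonneg_right h3 (abs_nonneg _))
    have h2 := congrFun hw j
    rw [weightHom_apply] at h2
    change d (Sum.inr j) ≤ (w j + ∑ q : Param Ω, (m : ℤ) * |q.2.1 j|).toNat
    omega

/-! ### Polynomial maps, substitution and the chain rule -/

/-- The family of series that the substitution `x ↦ H(a, x)` puts in place of the variables. -/
noncomputable abbrev PolyMap.family (H : PolyMap 𝕜 Ω) : Var Ω → MvPowerSeries (Var Ω) 𝕜 :=
  Sum.elim (fun q => MvPowerSeries.X (Sum.inl q))
    (fun j => ((H j : MvPolynomial (Var Ω) 𝕜) : MvPowerSeries (Var Ω) 𝕜))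

theorem PolyMap.hasSubst_family {H : PolyMap 𝕜 Ω}
    (hH : ∀ i, MvPolynomial.constantCoeff (H i) = 0) : MvPowerSeries.HasSubst H.family := by
  refine MvPowerSeries.hasSubst_of_constantCoeff_zero ?_
  rintro (q | j)
  · exact MvPowerSeries.constantCoeff_X _
  · exact hH j

theorem PolyMap.coe_bind₁ (H : PolyMap 𝕜 Ω) (p : MvPolynomial (Var Ω) 𝕜) :
    ((MvPolynomial.bind₁ (Sum.elim (fun q => MvPolynomial.X (Sum.inl q)) H) p :
      MvPolynomial (Var Ω) 𝕜) : MvPowerSeries (Var Ω) 𝕜) =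
      MvPowerSeries.subst H.family (p : MvPowerSeries (Var Ω) 𝕜) := by
  rw [MvPowerSeries.subst_coe]
  induction p using MvPolynomial.induction_on with
  | C r => simp [MvPowerSeries.algebraMap_apply]
  | add p q hp hq => rw [map_add, map_add, MvPolynomial.coe_add, hp, hq]
  | mul_X p v hp =>
    rw [map_mul, map_mul, MvPolynomial.coe_mul, hp, MvPolynomial.bind₁_X_right,
      MvPolynomial.aeval_X]
    rcases v with q | j
    · rw [Sum.elim_inl, MvPolynomial.coe_X]
      rfl
    · rfl

theorem subst_family_idMap (f : MvPowerSeries (Var Ω) 𝕜) :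
    MvPowerSeries.subst (idMap 𝕜 Ω).family f = f := by
  have h : (idMap 𝕜 Ω).family = MvPowerSeries.X := by
    ext1 v
    rcases v with q | j
    · rfl
    · exact MvPolynomial.coe_X _
  rw [h, MvPowerSeries.subst_self, id]

theorem transforms_idMap (V : FormalField 𝕜 Ω) : Transforms (idMap 𝕜 Ω) V V := by
  classical
  refine ⟨fun i => by simp [idMap], fun i => ?_⟩
  change _ = MvPowerSeries.subst (idMap 𝕜 Ω).family _
  rw [subst_family_idMap, Finset.sum_eq_single i]
  · simp [idMap]
  · intro j _ hj
    rw [idMap, MvPolynomial.pderiv_X_of_ne (by simpa using hj.symm), MvPolynomial.coe_zero,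
      zero_mul]
  · simp

/-- Transformations compose: this is the chain rule, together with the associativity of formal
substitution. -/
theorem Transforms.comp {G H : PolyMap 𝕜 Ω} {V₀ V₁ V₂ : FormalField 𝕜 Ω}
    (hG : Transforms G V₁ V₂) (hH : Transforms H V₀ V₁) :
    Transforms (PolyMap.comp G H) V₀ V₂ := by
  have sG := PolyMap.hasSubst_family hG.1
  have sH := PolyMap.hasSubst_family hH.1
  refine ⟨fun i => ?_, fun i => ?_⟩
  · change MvPowerSeries.constantCoeff
      ((PolyMap.comp G H i : MvPolynomial (Var Ω) 𝕜) : MvPowerSeries (Var Ω) 𝕜) = 0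
    rw [PolyMap.comp, PolyMap.coe_bind₁]
    refine MvPowerSeries.constantCoeff_subst_eq_zero sH ?_ (hG.1 i)
    rintro (q | j)
    · exact MvPowerSeries.constantCoeff_X _
    · exact hH.1 j
  · have hfam : (PolyMap.comp G H).family =
        fun v => MvPowerSeries.subst (R := 𝕜) H.family (G.family v) := by
      ext1 v
      rcases v with q | j
      · exact (MvPowerSeries.subst_X (R := 𝕜) sH (Sum.inl q)).symm
      · exact PolyMap.coe_bind₁ H (G j)
    change _ = MvPowerSeries.subst (PolyMap.comp G H).family _
    rw [hfam, ← MvPowerSeries.subst_comp_subst_apply (R := 𝕜) sG sH, ← hG.2 i,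
      ← MvPowerSeries.substAlgHom_apply (R := 𝕜) sH, map_sum]
    have hchain : ∀ j : Fin n,
        ((MvPolynomial.pderiv (Sum.inr j) (PolyMap.comp G H i) : MvPolynomial (Var Ω) 𝕜) :
          MvPowerSeries (Var Ω) 𝕜) =
        ∑ k : Fin n, MvPowerSeries.subst H.family
          ((MvPolynomial.pderiv (Sum.inr k) (G i) : MvPolynomial (Var Ω) 𝕜) :
            MvPowerSeries (Var Ω) 𝕜) *
          ((MvPolynomial.pderiv (Sum.inr j) (H k) : MvPolynomial (Var Ω) 𝕜) :
            MvPowerSeries (Var Ω) 𝕜) := by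
      intro j
      rw [PolyMap.comp, MvPolynomial.pderiv_bind₁, Fintype.sum_sum_type,
        Finset.sum_eq_zero fun q _ => ?_, zero_add]
      · rw [← MvPolynomial.coeToMvPowerSeries.ringHom_apply, map_sum]
        refine Finset.sum_congr rfl fun k _ => ?_
        rw [map_mul, MvPolynomial.coeToMvPowerSeries.ringHom_apply,
          MvPolynomial.coeToMvPowerSeries.ringHom_apply, PolyMap.coe_bind₁, Sum.elim_inr]
      · rw [Sum.elim_inl, MvPolynomial.pderiv_X_of_ne Sum.inl_ne_inr, mul_zero]
    simp only [hchain, Finset.sum_mul, map_mul, MvPowerSeries.substAlgHom_apply]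
    rw [Finset.sum_comm]
    refine Finset.sum_congr rfl fun k _ => ?_
    rw [show MvPowerSeries.subst H.family (V₁ k) = _ from (hH.2 k).symm, Finset.mul_sum]
    exact Finset.sum_congr rfl fun j _ => mul_assoc _ _ _

theorem iterComp_congr {H H' : ℕ → PolyMap 𝕜 Ω} {s : ℕ} (h : ∀ k, 1 ≤ k → k ≤ s → H k = H' k) :
    iterComp H s = iterComp H' s := by
  induction s with
  | zero => rfl
  | succ s ih =>
    rw [iterComp, iterComp, h (s + 1) (by omega) le_rfl, ih fun k h1 h2 => h k h1 (by omega)]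

/-! ### The homological equation -/

theorem HasLevelForm.sub_linear_mem {lam : Fin n → 𝕜} {V : FormalField 𝕜 Ω}
    (hV : HasLevelForm lam V) (i : Fin n) :
    V i - MvPowerSeries.C (lam i) * MvPowerSeries.X (Sum.inr i) ∈
      MvPowerSeries.levelIdeal 𝕜 (levelHom Ω) 1 := by
  intro d hd
  rw [map_sub, hV.2 i d (Nat.lt_one_iff.1 hd), sub_self]

/-- The family itself is in normal form up to level `0`. -/
theorem hasLevelForm_sysField (hΩ : IsAdmissible Ω) (lam : Fin n → 𝕜) :
    HasLevelForm lam (sysField Ω lam) := by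
  constructor
  · rw [memM_iff]
    intro i
    refine add_mem ?_ (sum_mem fun I _ => ?_)
    · rw [← MvPowerSeries.smul_eq_C_mul, ← weightHom_single_inr]
      exact Submodule.smul_mem _ _ (MvPowerSeries.X_mem_weightSubmodule _)
    · have h := MvPowerSeries.mul_mem_weightSubmodule
        (MvPowerSeries.X_mem_weightSubmodule (R := 𝕜) (ω := weightHom Ω)
          (Sum.inl (⟨i, I⟩ : Param Ω)))
        (MvPowerSeries.prod_mem_weightSubmodule (R := 𝕜) (ω := weightHom Ω) Finset.univ
          fun (j : Fin n) _ => MvPowerSeries.pow_mem_weightSubmodule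
            (MvPowerSeries.X_mem_weightSubmodule (Sum.inr j))
            (I.1 j + (if j = i then 1 else 0)).toNat)
      convert! h using 2
      ext j
      -- admissibility keeps `Int.toNat` from truncating the exponents
      have hnn : 0 ≤ I.1 j + (if j = i then 1 else 0) := by
        obtain ⟨h1, h2, -⟩ := hΩ i I.1 I.2
        split_ifs with hj
        · subst hj; omega
        · have := h2 j hj; omega
      rw [Pi.add_apply, Finset.sum_apply, Finset.sum_eq_single j]
      · simp only [weightHom_single_inl, weightHom_single_inr, Pi.smul_apply, Pi.single_eq_same,
          Pi.neg_apply, nsmul_eq_mul, mul_one, Int.toNat_of_nonneg hnn, Pi.single_apply]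
        ring
      · intro k _ hk
        rw [weightHom_single_inr, Pi.smul_apply, Pi.single_eq_of_ne hk.symm, smul_zero]
      · simp
  · intro i d hd
    have h : ∑ I : {I : Fin n → ℤ // I ∈ Ω i},
        (MvPowerSeries.X (Sum.inl ⟨i, I⟩) * ∏ j : Fin n, MvPowerSeries.X (Sum.inr j) ^
          (I.1 j + (if j = i then 1 else 0)).toNat : MvPowerSeries (Var Ω) 𝕜) ∈
        MvPowerSeries.levelIdeal 𝕜 (levelHom Ω) 1 := by
      refine sum_mem fun I _ => Ideal.mul_mem_right _ _ ?_
      have := MvPowerSeries.monomial_mem_levelIdeal (R := 𝕜) (ℓ := levelHom Ω)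
        (Finsupp.single (Sum.inl ⟨i, I⟩) 1) 1
      rwa [levelHom_single_inl] at this
    rw [sysField, map_add, h d (by rw [levelHom_apply]; omega), add_zero]

/-- For a monomial of weight `e_i`, the eigenvalue of the Lie bracket with `λ ⊙ x` is
`⟨L(μ), λ⟩`. -/
theorem sum_mul_sub_eq_of_weightHom {lam : Fin n → 𝕜} {i : Fin n} {d : Var Ω →₀ ℕ}
    (hd : weightHom Ω d = Pi.single i 1) :
    ∑ j : Fin n, (d (Sum.inr j) : 𝕜) * lam j - lam i = ∑ j : Fin n, (Lmap d j : 𝕜) * lam j := by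
  classical
  have h : ∀ j : Fin n, (d (Sum.inr j) : 𝕜) * lam j =
      (Lmap d j : 𝕜) * lam j + if j = i then lam j else 0 := by
    intro j
    have h1 := congrFun hd j
    rw [weightHom_apply, Pi.single_apply] at h1
    have h2 : (d (Sum.inr j) : 𝕜) = (Lmap d j : 𝕜) + if j = i then 1 else 0 := by
      have h3 : (d (Sum.inr j) : ℤ) = Lmap d j + if j = i then 1 else 0 := by linarith
      exact_mod_cast congrArg (Int.cast : ℤ → 𝕜) h3
    rw [h2]
    split_ifs <;> ring
  rw [Finset.sum_congr rfl fun j _ => h j, Finset.sum_add_distrib,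
    Finset.sum_ite_eq' Finset.univ i, if_pos (Finset.mem_univ i), add_sub_cancel_right]

/-- A series of weight `e_i` has no constant term, since the constant monomial has weight `0`. -/
theorem constantCoeff_eq_zero_of_mem_weightSubmodule {i : Fin n} {f : MvPowerSeries (Var Ω) 𝕜}
    (hf : f ∈ MvPowerSeries.weightSubmodule 𝕜 (weightHom Ω) (Pi.single i 1)) :
    MvPowerSeries.coeff 0 f = 0 := by
  by_contra h
  have := congrFun (hf 0 h) i
  rw [map_zero, Pi.single_eq_same] at this
  exact zero_ne_one this

theorem pderiv_mem_levelIdeal {m : ℕ} {p : MvPolynomial (Var Ω) 𝕜} (j : Fin n)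
    (hp : (p : MvPowerSeries (Var Ω) 𝕜) ∈ MvPowerSeries.levelIdeal 𝕜 (levelHom Ω) m) :
    ((MvPolynomial.pderiv (Sum.inr j) p : MvPolynomial (Var Ω) 𝕜) : MvPowerSeries (Var Ω) 𝕜) ∈
      MvPowerSeries.levelIdeal 𝕜 (levelHom Ω) m := by
  intro d hd
  have h := hp (d + Finsupp.single (Sum.inr j) 1) (by
    rwa [map_add, levelHom_single_inr, add_zero])
  rw [MvPolynomial.coeff_coe] at h ⊢
  rw [MvPolynomial.coeff_pderiv, h, zero_mul]

theorem pderiv_mem_weightSubmodule {w : Fin n → ℤ} {p : MvPolynomial (Var Ω) 𝕜} (j : Fin n)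
    (hp : (p : MvPowerSeries (Var Ω) 𝕜) ∈ MvPowerSeries.weightSubmodule 𝕜 (weightHom Ω) w) :
    ((MvPolynomial.pderiv (Sum.inr j) p : MvPolynomial (Var Ω) 𝕜) : MvPowerSeries (Var Ω) 𝕜) ∈
      MvPowerSeries.weightSubmodule 𝕜 (weightHom Ω) (w - Pi.single j 1) := by
  intro d hd
  rw [MvPolynomial.coeff_coe, MvPolynomial.coeff_pderiv] at hd
  rw [← hp (d + Finsupp.single (Sum.inr j) 1) (left_ne_zero_of_mul hd), map_add,
    weightHom_single_inr, add_sub_cancel_right]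

/-- A near-identity map `x + h` with `h ∈ M` of level at least `s + 1` transforms every field of
the form `λ ⊙ x + ⋯` into one of the same form, and up to level `s + 1` the only change is the
addition of the Lie bracket of `h` with the linear part `λ ⊙ x`. -/
theorem exists_transforms_of_level {lam : Fin n → 𝕜} {V : FormalField 𝕜 Ω}
    (hV : HasLevelForm lam V) {s : ℕ} {h : PolyMap 𝕜 Ω}
    (hw : ∀ i, (h i : MvPowerSeries (Var Ω) 𝕜) ∈
      MvPowerSeries.weightSubmodule 𝕜 (weightHom Ω) (Pi.single i 1))
    (hl : ∀ i, (h i : MvPowerSeries (Var Ω) 𝕜) ∈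
      MvPowerSeries.levelIdeal 𝕜 (levelHom Ω) (s + 1)) :
    ∃ W : FormalField 𝕜 Ω, Transforms (fun i => MvPolynomial.X (Sum.inr i) + h i) V W ∧ MemM W ∧
      ∀ i d, level d ≤ s + 1 → MvPowerSeries.coeff d (W i) = MvPowerSeries.coeff d (V i) +
        (∑ j : Fin n, (d (Sum.inr j) : 𝕜) * lam j - lam i) * (h i).coeff d := by
  classical
  set H : PolyMap 𝕜 Ω := fun i => MvPolynomial.X (Sum.inr i) + h i with hH
  have hcoe : ∀ i, ((H i : MvPolynomial (Var Ω) 𝕜) : MvPowerSeries (Var Ω) 𝕜) =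
      MvPowerSeries.X (Sum.inr i) + (h i : MvPowerSeries (Var Ω) 𝕜) := fun i => by
    rw [hH, MvPolynomial.coe_add, MvPolynomial.coe_X]
  have hHw : ∀ i, ((H i : MvPolynomial (Var Ω) 𝕜) : MvPowerSeries (Var Ω) 𝕜) ∈
      MvPowerSeries.weightSubmodule 𝕜 (weightHom Ω) (Pi.single i 1) := fun i => by
    rw [hcoe]
    refine add_mem ?_ (hw i)
    rw [← weightHom_single_inr]
    exact MvPowerSeries.X_mem_weightSubmodule _
  have hc : ∀ i, MvPolynomial.constantCoeff (H i) = 0 := fun i =>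
    constantCoeff_eq_zero_of_mem_weightSubmodule (hHw i)
  have sH := PolyMap.hasSubst_family hc
  have hfw : ∀ v, H.family v ∈ MvPowerSeries.weightSubmodule 𝕜 (weightHom Ω)
      (weightHom Ω (Finsupp.single v 1)) := by
    rintro (q | j)
    · exact MvPowerSeries.X_mem_weightSubmodule _
    · rw [weightHom_single_inr]; exact hHw j
  have hfl : ∀ v, H.family v - MvPowerSeries.X v ∈ MvPowerSeries.levelIdeal 𝕜 (levelHom Ω)
      (levelHom Ω (Finsupp.single v 1) + (s + 1)) := by
    rintro (q | j)
    · simp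
    · rw [levelHom_single_inr, zero_add, PolyMap.family, Sum.elim_inr, hcoe, add_sub_cancel_left]
      exact hl j
  let T := (MvPowerSeries.substAlgHom (R := 𝕜) sH).toLinearMap
  have hTa : ∀ f, T f = MvPowerSeries.subst H.family f := fun f =>
    MvPowerSeries.substAlgHom_apply sH f
  have hTs : ∀ m, ∀ f ∈ MvPowerSeries.levelIdeal 𝕜 (levelHom Ω) m,
      T f - f ∈ MvPowerSeries.levelIdeal 𝕜 (levelHom Ω) (m + (s + 1)) := fun m f hf => by
    rw [hTa]
    exact MvPowerSeries.subst_sub_self_mem_levelIdeal sH hfl hf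
  have hT : ∀ m, ∀ f ∈ MvPowerSeries.levelIdeal 𝕜 (levelHom Ω) m,
      T f - f ∈ MvPowerSeries.levelIdeal 𝕜 (levelHom Ω) (m + 1) := fun m f hf =>
    MvPowerSeries.levelIdeal_anti (by omega) (hTs m f hf)
  set F : FormalField 𝕜 Ω := fun i => ∑ j : Fin n,
    ((MvPolynomial.pderiv (Sum.inr j) (H i) : MvPolynomial (Var Ω) 𝕜) :
      MvPowerSeries (Var Ω) 𝕜) * V j with hF
  have hFw : ∀ i, F i ∈ MvPowerSeries.weightSubmodule 𝕜 (weightHom Ω) (Pi.single i 1) := by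
    refine fun i => sum_mem fun j _ => ?_
    have := MvPowerSeries.mul_mem_weightSubmodule (pderiv_mem_weightSubmodule j (hHw i))
      (memM_iff.1 hV.1 j)
    rwa [sub_add_cancel] at this
  have hFV : ∀ i, F i = V i + ∑ j : Fin n,
      ((MvPolynomial.pderiv (Sum.inr j) (h i) : MvPolynomial (Var Ω) 𝕜) :
        MvPowerSeries (Var Ω) 𝕜) * V j := by
    intro i
    have hid := ((transforms_idMap V).2 i).trans (subst_family_idMap (V i))
    simp only [hF, hH, map_add, MvPolynomial.coe_add, add_mul, Finset.sum_add_distrib]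
    rw [← hid]
    rfl
  choose W hWw hWT using fun i => MvPowerSeries.exists_mem_weightSubmodule_map_eq hT
    (fun f hf => by rw [hTa]; exact MvPowerSeries.subst_mem_weightSubmodule sH hfw hf) (hFw i)
  refine ⟨W, ⟨hc, fun i => ?_⟩, memM_iff.2 hWw, fun i d hd => ?_⟩
  · exact (hWT i).symm.trans (hTa _)
  · -- `W₀` is the candidate for `W i` up to level `s + 1`: the substitution takes it to `F i`
    -- modulo level `s + 2`, and `T` is injective modulo each level
    set D : MvPowerSeries (Var Ω) 𝕜 := ∑ j : Fin n,
      ((MvPolynomial.pderiv (Sum.inr j) (h i) : MvPolynomial (Var Ω) 𝕜) :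
        MvPowerSeries (Var Ω) 𝕜) * (MvPowerSeries.C (lam j) * MvPowerSeries.X (Sum.inr j)) with hD
    set W₀ : MvPowerSeries (Var Ω) 𝕜 :=
      V i + D - MvPowerSeries.C (lam i) * (h i : MvPowerSeries (Var Ω) 𝕜) with hW₀
    have hDl : D ∈ MvPowerSeries.levelIdeal 𝕜 (levelHom Ω) (s + 1) :=
      sum_mem fun j _ => Ideal.mul_mem_right _ _ (pderiv_mem_levelIdeal j (hl i))
    have h1 : W₀ - MvPowerSeries.C (lam i) * MvPowerSeries.X (Sum.inr i) ∈
        MvPowerSeries.levelIdeal 𝕜 (levelHom Ω) 1 := by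
      have := sub_mem (add_mem (hV.sub_linear_mem i)
        (MvPowerSeries.levelIdeal_anti (Nat.le_add_left 1 s) hDl))
        (Ideal.mul_mem_left _ (MvPowerSeries.C (lam i))
          (MvPowerSeries.levelIdeal_anti (Nat.le_add_left 1 s) (hl i)))
      convert! this using 1
      rw [hW₀]; ring
    have h2 : T (MvPowerSeries.C (lam i) * MvPowerSeries.X (Sum.inr i)) =
        MvPowerSeries.C (lam i) * (MvPowerSeries.X (Sum.inr i) +
          (h i : MvPowerSeries (Var Ω) 𝕜)) := by
      rw [← MvPowerSeries.smul_eq_C_mul, map_smul, hTa, MvPowerSeries.subst_X sH,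
        PolyMap.family, Sum.elim_inr, hcoe, MvPowerSeries.smul_eq_C_mul]
    have h3 : F i - (V i + D) ∈ MvPowerSeries.levelIdeal 𝕜 (levelHom Ω) (s + 1 + 1) := by
      rw [hFV, add_sub_add_left_eq_sub, hD, ← Finset.sum_sub_distrib]
      refine sum_mem fun j _ => ?_
      rw [← mul_sub]
      exact MvPowerSeries.mul_mem_levelIdeal (pderiv_mem_levelIdeal j (hl i))
        (hV.sub_linear_mem j)
    have h4 : W i - W₀ ∈ MvPowerSeries.levelIdeal 𝕜 (levelHom Ω) (s + 1 + 1) := by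
      refine MvPowerSeries.mem_levelIdeal_of_map_mem hT ?_
      have h5 := hTs 1 _ h1
      rw [map_sub, h2, add_comm 1] at h5
      rw [map_sub, hWT]
      convert! sub_mem h3 h5 using 1
      rw [hW₀]; ring
    have h6 := h4 d (Nat.lt_succ_of_le hd)
    rw [map_sub, sub_eq_zero] at h6
    have h7 : MvPowerSeries.coeff d D =
        ∑ j : Fin n, (d (Sum.inr j) : 𝕜) * lam j * (h i).coeff d := by
      rw [hD, map_sum]
      refine Finset.sum_congr rfl fun j _ => ?_
      rw [mul_left_comm, MvPowerSeries.coeff_C_mul, ← MvPolynomial.coe_X, ← MvPolynomial.coe_mul,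
        MvPolynomial.coeff_coe, MvPolynomial.coeff_pderiv_mul_X]
      ring
    rw [h6, hW₀, map_sub, map_add, h7, MvPowerSeries.coeff_C_mul, MvPolynomial.coeff_coe,
      ← Finset.sum_mul]
    ring

/-- One normalization step: a field in normal form up to level `s` is brought into normal form up
to level `s + 1` by solving the homological equation for the nonresonant terms of level
`s + 1`. -/
theorem IsNormalFormUpToLevel.exists_succ {lam : Fin n → 𝕜} {s : ℕ} {V : FormalField 𝕜 Ω}
    (hV : IsNormalFormUpToLevel lam s V) :
    ∃ H : PolyMap 𝕜 Ω, LevelAtLeast (s + 1) (PolyMap.subId H) ∧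
      ∃ W : FormalField 𝕜 Ω, Transforms H V W ∧ IsNormalFormUpToLevel lam (s + 1) W := by
  classical
  -- the bracket with `λ ⊙ x` multiplies the coefficient of `h` by `⟨L(μ), λ⟩`; at resonant terms
  -- the quotient is `0` by convention and `h` has no such term
  let c : Fin n → (Var Ω →₀ ℕ) → 𝕜 := fun i d =>
    if level d = s + 1 ∧ weightHom Ω d = Pi.single i 1 then
      -MvPowerSeries.coeff d (V i) / ∑ j : Fin n, (Lmap d j : 𝕜) * lam j else 0
  let h : PolyMap 𝕜 Ω := fun i =>
    ∑ d ∈ (finite_level_weight (s + 1) (Pi.single i 1)).toFinset, MvPolynomial.monomial d (c i d)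
  have hcoeff : ∀ i d, (h i).coeff d = c i d := by
    intro i d
    simp only [h, MvPolynomial.coeff_sum, MvPolynomial.coeff_monomial]
    rw [Finset.sum_ite_eq', ite_eq_left_iff, Set.Finite.mem_toFinset]
    exact fun hd => (if_neg hd).symm
  have hw : ∀ i, (h i : MvPowerSeries (Var Ω) 𝕜) ∈
      MvPowerSeries.weightSubmodule 𝕜 (weightHom Ω) (Pi.single i 1) :=
    fun i d hd => (ite_ne_right_iff.1 ((hcoeff i d).symm.trans_ne hd)).1.2
  have hl : ∀ i, (h i : MvPowerSeries (Var Ω) 𝕜) ∈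
      MvPowerSeries.levelIdeal 𝕜 (levelHom Ω) (s + 1) := by
    intro i d hd
    rw [MvPolynomial.coeff_coe, hcoeff]
    exact if_neg fun h' => by rw [levelHom_apply] at hd; omega
  have hsub : PolyMap.subId (fun i => MvPolynomial.X (Sum.inr i) + h i) =
      fun i => (h i : MvPowerSeries (Var Ω) 𝕜) := by
    ext1 i
    rw [PolyMap.subId, add_sub_cancel_left]
  obtain ⟨W, hT, hM, hW⟩ := exists_transforms_of_level hV.1 hw hl
  have hlow : ∀ i d, level d ≤ s → MvPowerSeries.coeff d (W i) = MvPowerSeries.coeff d (V i) := by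
    intro i d hd
    rw [hW i d (by omega), hcoeff, show c i d = 0 from if_neg fun h' => by omega, mul_zero,
      add_zero]
  refine ⟨_, ?_, W, hT, ⟨hM, fun i d hd => ?_⟩, fun i d h1 h2 hr => ?_⟩
  · rw [hsub]
    refine ⟨memM_iff.2 hw, fun i d hd => ?_⟩
    by_contra hlt
    exact hd (hl i d (not_le.1 hlt))
  · rw [hlow i d (by omega), hV.1.2 i d hd]
  · rcases Nat.lt_or_ge s (level d) with hs | hs
    · rw [hW i d h2, hcoeff]
      by_cases hd : weightHom Ω d = Pi.single i 1
      · have hr' : ∑ j : Fin n, (Lmap d j : 𝕜) * lam j ≠ 0 := hr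
        rw [sum_mul_sub_eq_of_weightHom hd,
          show c i d = _ from if_pos ⟨le_antisymm h2 hs, hd⟩, mul_div_cancel₀ _ hr',
          add_neg_cancel]
      · have hVd : MvPowerSeries.coeff d (V i) = 0 := by
          by_contra hne
          exact hd (memM_iff.1 hV.1.1 i d hne)
        rw [hVd, show c i d = 0 from if_neg fun h' => hd h'.2, mul_zero, add_zero]
    · rw [hlow i d hs, hV.2 i d h1 hs hr]

end Family

theorem mainTheorem2 {𝕜 : Type*} [RCLike 𝕜] (n : ℕ) (Ω : Fin n → Finset (Fin n → ℤ))
    (hΩ : IsAdmissible Ω) (lam : Fin n → 𝕜) (s : ℕ) :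
    ∃ H : ℕ → PolyMap 𝕜 Ω,
      (∀ k, 1 ≤ k → k ≤ s → LevelAtLeast k (PolyMap.subId (H k))) ∧
      ∃ W : FormalField 𝕜 Ω,
        Transforms (iterComp H s) (sysField Ω lam) W ∧ IsNormalFormUpToLevel lam s W := by
  induction s with
  | zero =>
    exact ⟨fun _ => idMap 𝕜 Ω, fun k h1 h2 => by omega, sysField Ω lam, transforms_idMap _,
      hasLevelForm_sysField hΩ lam, fun i d h1 h2 => by omega⟩
  | succ s ih =>
    obtain ⟨H, hH, V, hT, hV⟩ := ih
    obtain ⟨G, hG, W, hGT, hW⟩ := hV.exists_succ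
    refine ⟨Function.update H (s + 1) G, fun k h1 h2 => ?_, W, ?_, hW⟩
    · rcases eq_or_ne k (s + 1) with rfl | hk
      · rwa [Function.update_self]
      · rw [Function.update_of_ne hk]
        exact hH k h1 (by omega)
    · rw [iterComp, Function.update_self, iterComp_congr (H' := H) fun k _ h2 =>
        Function.update_of_ne (by omega) _ _]
      exact hGT.comp hT
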